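/- Let $p$ be a prime number and let $q$ be a rational number with $0<q<1$ whose denominator (in lowest terms) is a power of $p$. Let $\xi$ be a nonzero rational number. For $n\ge 0$ put $n_q=\frac{1-q^n}{1-q}$ and $n_q!=\prod_{m=1}^n m_q$, and let $E_q(z)=\sum_{n\ge 0}\frac{z^n}{n_q!}$ be the $q$-exponential; define $E_{q^{-1}}$ in the same way with $q^{-1}$ in place of $q$. Then the series $E_q(\xi)$ converges in $\mathbb{Q}_p$, and the $p$-adic number $E_q(\xi)$ is irrational (that is, not in $\mathbb{Q}$) or zero. Moreover, if $|\xi|_p<1$, then the series $E_{q^{-1}}(\xi)$ converges in $\mathbb{Q}_p$, and the $p$-adic number $E_{q^{-1}}(\xi)$ is irrational. -/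

import Mathlib

/-- The `q`-analogue `n_q = (1 - q ^ n) / (1 - q)` of the integer `n` (for `q ≠ 1`). -/
def qNumber {K : Type*} [Field K] (q : K) (n : ℕ) : K :=
  (1 - q ^ n) / (1 - q)

/-- The `q`-factorial `n_q! = ∏_{m = 1}^n m_q`. -/
def qFactorial {K : Type*} [Field K] (q : K) (n : ℕ) : K :=
  ∏ m ∈ Finset.Icc 1 n, qNumber q m

/-- The `n`-th term `z ^ n / n_q!` of the `q`-exponential series. -/
def qExpTerm {K : Type*} [Field K] (q z : K) (n : ℕ) : K :=
  z ^ n / qFactorial q n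

/-- The value `E_q(z) = ∑_{n ≥ 0} z ^ n / n_q!` of the `q`-exponential in a topological field
(meaningful where the series converges). -/
noncomputable def qExpSeries {K : Type*} [Field K] [TopologicalSpace K] (q z : K) : K :=
  ∑' n : ℕ, qExpTerm q z n

/-- A `p`-adic number is irrational if it is not in the image of `ℚ`. -/
def IsPadicIrrational {p : ℕ} [Fact p.Prime] (x : ℚ_[p]) : Prop :=
  x ∉ Set.range ((↑) : ℚ → ℚ_[p])

/-! Put `Q = q⁻¹ = P / a` in lowest terms, so that `|Q|_p = 1 / P < 1` and `a < P`. Then `E_q(ξ) =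
F(w)` with `w = ξ (Q - 1)`, where `F(x) = ∑ eulerTerm Q x s` converges everywhere and satisfies
`F(x) = (1 - x) F(Q x)` (`eulerSeries_eq`).

Since `F(Q ^ i x)` weights the `s`-th term by `(Q ^ s) ^ i`, a polynomial in `Y = Q ^ s` of degree
at most `n` inserted as a weight gives a combination of `F(x), ..., F(Q ^ n x)`, which becomes a
multiple of `F(x)` after multiplication by `eulerProd Q x n`. Choosing the polynomial with roots `Q
^ s`, `n < s ≤ 2n`, opens a gap in the series and yields a Padé-type approximation
(`hasSum_padeWeight`, `exists_remainder`). The first term of the remainder dominates, so its norm is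
known exactly and it is nonzero.

If `F(w)` were rational and nonzero, clearing denominators would give nonzero integers of absolute
value at most `C ^ n * P ^ e`, up to a factor linear in `n`, and of `p`-adic norm at most `C' ^ n *
P ^ (-(e + n ^ 2 + n))`. This contradicts `1 ≤ |z| * |z|_p` for large `n`
(`eulerSeries_irrational_or_zero`).

The second claim follows from `E_{1/q}(ξ) * E_q(-ξ) = 1` (`eulerInvSeries_mul_eulerSeries`). -/

/-! ### Algebra of the Euler series and of the approximants -/

section Algebra

variable {K : Type*} [Field K]

/-- The product `∏_{m = 1}^s (Q ^ m - 1)`. -/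
def qPoch (Q : K) (s : ℕ) : K :=
  ∏ m ∈ Finset.range s, (Q ^ (m + 1) - 1)

/-- The `s`-th term of the entire series `∑ Q ^ (s choose 2) x ^ s / ∏_{m ≤ s} (Q ^ m - 1)`. -/
def eulerTerm (Q x : K) (s : ℕ) : K :=
  Q ^ (s.choose 2) * x ^ s / qPoch Q s

/-- The product `∏_{l < n} (1 - Q ^ l x)`. -/
def eulerProd (Q x : K) (n : ℕ) : K :=
  ∏ l ∈ Finset.range n, (1 - Q ^ l * x)

/-- The image of `Y ^ i ∏_{t < j} (Q ^ (n + t + 1) - Y)` under the linear map with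
`Y ^ i ↦ ∏_{i ≤ l < n} (1 - Q ^ l x)`. -/
def shiftForm (Q x : K) (n : ℕ) : ℕ → ℕ → K
  | 0, i => ∏ l ∈ Finset.range n, if i ≤ l then 1 - Q ^ l * x else 1
  | j + 1, i => Q ^ (n + j + 1) * shiftForm Q x n j i - shiftForm Q x n j (i + 1)

/-- The product `∏_{t < j} (Q ^ (n + t + 1) - Q ^ s)`. -/
def padeWeight (Q : K) (n j s : ℕ) : K :=
  ∏ t ∈ Finset.range j, (Q ^ (n + t + 1) - Q ^ s)

theorem qPoch_zero (Q : K) : qPoch Q 0 = 1 := by simp [qPoch]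

theorem qPoch_succ (Q : K) (s : ℕ) : qPoch Q (s + 1) = qPoch Q s * (Q ^ (s + 1) - 1) :=
  Finset.prod_range_succ _ _

theorem padeWeight_succ (Q : K) (n j s : ℕ) :
    padeWeight Q n (j + 1) s = padeWeight Q n j s * (Q ^ (n + j + 1) - Q ^ s) :=
  Finset.prod_range_succ _ _

theorem padeWeight_eq_zero (Q : K) {n j s : ℕ} (h1 : n < s) (h2 : s ≤ n + j) :
    padeWeight Q n j s = 0 := by
  refine Finset.prod_eq_zero (i := s - n - 1) (by simp; omega) ?_
  rw [show n + (s - n - 1) + 1 = s by omega, sub_self]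

theorem eulerTerm_zero (Q x : K) : eulerTerm Q x 0 = 1 := by simp [eulerTerm, qPoch]

theorem eulerTerm_pow_mul (Q x : K) (i s : ℕ) :
    eulerTerm Q (Q ^ i * x) s = eulerTerm Q x s * (Q ^ s) ^ i := by
  simp only [eulerTerm, mul_pow, ← pow_mul, mul_comm i s]
  ring

theorem eulerTerm_mul (Q x : K) (s : ℕ) :
    eulerTerm Q (Q * x) s = eulerTerm Q x s * Q ^ s := by
  simpa using eulerTerm_pow_mul Q x 1 s

theorem eulerTerm_succ {Q : K} (x : K) (s : ℕ) (h : Q ^ (s + 1) - 1 ≠ 0) :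
    eulerTerm Q x (s + 1) * (Q ^ (s + 1) - 1) = x * eulerTerm Q (Q * x) s := by
  rw [eulerTerm_mul, eulerTerm, eulerTerm, qPoch_succ, Nat.choose_succ_succ' s 1]
  simp only [Nat.choose_one_right]
  rw [div_mul_eq_mul_div, mul_div_mul_right _ _ h]
  ring

theorem eulerProd_succ (Q x : K) (n : ℕ) :
    eulerProd Q x (n + 1) = eulerProd Q x n * (1 - Q ^ n * x) :=
  Finset.prod_range_succ _ _

theorem eulerProd_eq_mul_shiftForm (Q x : K) {n i : ℕ} (hi : i ≤ n) :
    eulerProd Q x n = eulerProd Q x i * shiftForm Q x n 0 i := by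
  obtain ⟨d, rfl⟩ := Nat.exists_eq_add_of_le hi
  simp only [eulerProd, shiftForm]
  rw [Finset.prod_range_add, Finset.prod_range_add]
  have : ∏ l ∈ Finset.range i, (if i ≤ l then 1 - Q ^ l * x else 1) = 1 :=
    Finset.prod_eq_one fun l hl => by simp at hl; simp [hl]
  rw [this]
  simp

end Algebra

/-! ### Ultrametric estimates, the functional equation and the Padé remainder -/

section Analysis

variable {K : Type*} [NormedField K] [IsUltrametricDist K]

theorem norm_sub_eq_left_of_norm_lt {x y : K} (h : ‖y‖ < ‖x‖) : ‖x - y‖ = ‖x‖ := by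
  have := IsUltrametricDist.norm_add_eq_max_of_norm_ne_norm (x := x) (y := -y)
    (by rw [norm_neg]; exact h.ne')
  rw [sub_eq_add_neg, this, norm_neg, max_eq_left h.le]

theorem norm_pow_succ_sub_one {Q : K} (hQ : ‖Q‖ < 1) (m : ℕ) : ‖Q ^ (m + 1) - 1‖ = 1 := by
  rw [norm_sub_rev, norm_sub_eq_left_of_norm_lt] <;> rw [norm_one]
  rw [norm_pow]
  exact pow_lt_one₀ (norm_nonneg _) hQ (by omega)

theorem pow_succ_sub_one_ne_zero {Q : K} (hQ : ‖Q‖ < 1) (m : ℕ) : Q ^ (m + 1) - 1 ≠ 0 := by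
  rw [← norm_ne_zero_iff, norm_pow_succ_sub_one hQ]
  exact one_ne_zero

theorem norm_qPoch {Q : K} (hQ : ‖Q‖ < 1) (s : ℕ) : ‖qPoch Q s‖ = 1 := by
  rw [qPoch, norm_prod]
  exact Finset.prod_eq_one fun m _ => norm_pow_succ_sub_one hQ m

theorem qPoch_ne_zero {Q : K} (hQ : ‖Q‖ < 1) (s : ℕ) : qPoch Q s ≠ 0 := by
  rw [← norm_ne_zero_iff, norm_qPoch hQ]
  exact one_ne_zero

theorem norm_eulerTerm {Q : K} (hQ : ‖Q‖ < 1) (x : K) (s : ℕ) :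
    ‖eulerTerm Q x s‖ = ‖Q‖ ^ (s.choose 2) * ‖x‖ ^ s := by
  simp [eulerTerm, norm_qPoch hQ]

theorem norm_eulerTerm_succ {Q : K} (hQ : ‖Q‖ < 1) (x : K) (s : ℕ) :
    ‖eulerTerm Q x (s + 1)‖ = ‖Q‖ ^ s * ‖x‖ * ‖eulerTerm Q x s‖ := by
  rw [norm_eulerTerm hQ, norm_eulerTerm hQ, Nat.choose_succ_succ' s 1]
  simp only [Nat.choose_one_right]
  ring

theorem norm_padeWeight {Q : K} (hQ0 : Q ≠ 0) (hQ : ‖Q‖ < 1) {n j s : ℕ} (hs : n + j < s) :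
    ‖padeWeight Q n j s‖ = ‖Q‖ ^ (∑ t ∈ Finset.range j, (n + t + 1)) := by
  rw [padeWeight, norm_prod, ← Finset.prod_pow_eq_pow_sum]
  refine Finset.prod_congr rfl fun t ht => ?_
  rw [Finset.mem_range] at ht
  rw [norm_sub_eq_left_of_norm_lt, norm_pow]
  rw [norm_pow, norm_pow]
  exact pow_lt_pow_right_of_lt_one₀ (norm_pos_iff.2 hQ0) hQ (by omega)

/-- A series whose terms decrease geometrically in an ultrametric field has the norm of its
first term. -/
theorem norm_tsum_eq_norm_zero {f : ℕ → K} (hf : Summable f) {r : ℝ} (hr0 : 0 ≤ r) (hr : r < 1)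
    (h : ∀ s, ‖f (s + 1)‖ ≤ r * ‖f s‖) : ‖∑' s, f s‖ = ‖f 0‖ := by
  have hle : ∀ s, ‖f (s + 1)‖ ≤ r * ‖f 0‖ := by
    intro s
    induction s with
    | zero => exact h 0
    | succ s ih =>
      refine (h (s + 1)).trans (le_trans ?_ ih)
      exact mul_le_of_le_one_left (norm_nonneg _) hr.le
  rw [hf.tsum_eq_zero_add]
  have htail : ‖∑' s, f (s + 1)‖ ≤ r * ‖f 0‖ :=
    IsUltrametricDist.norm_tsum_le_of_forall_le_of_nonneg (by positivity) hle
  rcases eq_or_ne (f 0) 0 with h0 | h0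
  · rw [h0, norm_zero, mul_zero] at htail
    rw [h0, zero_add, norm_zero]
    exact le_antisymm htail (norm_nonneg _)
  · have hlt : ‖∑' s, f (s + 1)‖ < ‖f 0‖ :=
      htail.trans_lt (mul_lt_of_lt_one_left (norm_pos_iff.2 h0) hr)
    rw [IsUltrametricDist.norm_add_eq_max_of_norm_ne_norm hlt.ne', max_eq_left hlt.le]

variable [CompleteSpace K]

theorem summable_eulerTerm {Q : K} (hQ : ‖Q‖ < 1) (x : K) : Summable (eulerTerm Q x) := by
  have hlim : Filter.Tendsto (fun s : ℕ => ‖Q‖ ^ s * ‖x‖) Filter.atTop (nhds (0 * ‖x‖)) :=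
    (tendsto_pow_atTop_nhds_zero_of_lt_one (norm_nonneg _) hQ).mul_const _
  rw [zero_mul] at hlim
  refine summable_of_ratio_norm_eventually_le (r := 1 / 2) (by norm_num) ?_
  filter_upwards [hlim.eventually_le_const (show (0 : ℝ) < 1 / 2 by norm_num)] with s hs
  rw [norm_eulerTerm_succ hQ]
  exact mul_le_mul_of_nonneg_right hs (norm_nonneg _)

theorem eulerSeries_eq {Q : K} (hQ : ‖Q‖ < 1) (x : K) :
    ∑' s, eulerTerm Q x s = (1 - x) * ∑' s, eulerTerm Q (Q * x) s := by
  have h1 := summable_eulerTerm hQ x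
  have h2 := summable_eulerTerm hQ (Q * x)
  have h : ∀ s, eulerTerm Q (Q * x) (s + 1) - eulerTerm Q x (s + 1)
      = x * eulerTerm Q (Q * x) s := fun s => by
    rw [← eulerTerm_succ x s (pow_succ_sub_one_ne_zero hQ s), eulerTerm_mul]
    ring
  have key : ∑' s, eulerTerm Q (Q * x) s - ∑' s, eulerTerm Q x s
      = x * ∑' s, eulerTerm Q (Q * x) s := by
    rw [← tsum_mul_left, ← tsum_congr h, Summable.tsum_sub
      ((summable_nat_add_iff 1).2 h2) ((summable_nat_add_iff 1).2 h1),
      h1.tsum_eq_zero_add, h2.tsum_eq_zero_add, eulerTerm_zero, eulerTerm_zero]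
    ring
  linear_combination -key

theorem eulerSeries_eq_eulerProd_mul {Q : K} (hQ : ‖Q‖ < 1) (x : K) (n : ℕ) :
    ∑' s, eulerTerm Q x s = eulerProd Q x n * ∑' s, eulerTerm Q (Q ^ n * x) s := by
  induction n with
  | zero => simp [eulerProd]
  | succ n ih =>
    rw [ih, eulerSeries_eq hQ (Q ^ n * x), eulerProd_succ, ← mul_assoc Q, ← pow_succ' Q n]
    ring

/-- For `j = 0` this is the series of `F(Q ^ i x)` combined with `F(x) = eulerProd Q x i * F(Q ^ i
x)`. Each step in `j` multiplies the weight by `Q ^ (n + j + 1) - Y`; the condition `i + j ≤ n`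
keeps its degree in `Y` at most `n`. -/
theorem hasSum_padeWeight {Q : K} (hQ : ‖Q‖ < 1) (x : K) (n j i : ℕ) (h : i + j ≤ n) :
    HasSum (fun s => eulerProd Q x n * (eulerTerm Q x s * (Q ^ s) ^ i * padeWeight Q n j s))
      ((∑' s, eulerTerm Q x s) * shiftForm Q x n j i) := by
  induction j generalizing i with
  | zero =>
    have := (summable_eulerTerm hQ (Q ^ i * x)).hasSum.mul_left (eulerProd Q x n)
    rw [eulerProd_eq_mul_shiftForm Q x (show i ≤ n by omega), mul_right_comm,
      ← eulerSeries_eq_eulerProd_mul hQ x i,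
      ← eulerProd_eq_mul_shiftForm Q x (show i ≤ n by omega)] at this
    simpa [padeWeight, eulerTerm_pow_mul] using this
  | succ j ih =>
    have h1 := (ih i (by omega)).mul_left (Q ^ (n + j + 1))
    have h2 := ih (i + 1) (by omega)
    have h3 := h1.sub h2
    have hval : (∑' s, eulerTerm Q x s) * shiftForm Q x n (j + 1) i
        = Q ^ (n + j + 1) * ((∑' s, eulerTerm Q x s) * shiftForm Q x n j i)
          - (∑' s, eulerTerm Q x s) * shiftForm Q x n j (i + 1) := by
      simp only [shiftForm]
      ring
    rw [hval]
    refine h3.congr_fun ?_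
    intro s
    rw [padeWeight_succ]
    ring

/-- The remainder of the Padé-type approximation. -/
theorem exists_remainder {Q x : K} (hQ0 : Q ≠ 0) (hQ : ‖Q‖ < 1) {n : ℕ}
    (hn : ‖Q‖ ^ n * ‖x‖ < 1) (hP : eulerProd Q x n ≠ 0) :
    ∃ R : K, ‖R‖ = ‖Q‖ ^ ((2 * n + 1).choose 2 + ∑ t ∈ Finset.range n, (n + t + 1))
        * ‖x‖ ^ (2 * n + 1) ∧
      (∑' s, eulerTerm Q x s) * shiftForm Q x n n 0
        - eulerProd Q x n * ∑ s ∈ Finset.range (n + 1), eulerTerm Q x s * padeWeight Q n n s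
      = eulerProd Q x n * R := by
  obtain ⟨f, hfdef⟩ : ∃ f : ℕ → K, ∀ s, f s = eulerTerm Q x s * padeWeight Q n n s :=
    ⟨_, fun _ => rfl⟩
  have hsum := hasSum_padeWeight hQ x n n 0 (by omega)
  simp only [pow_zero, mul_one, ← hfdef] at hsum ⊢
  have hf : Summable f := (summable_mul_left_iff hP).1 hsum.summable
  have hnorm : ∀ s, ‖f (s + (2 * n + 1))‖ = ‖eulerTerm Q x (s + (2 * n + 1))‖
      * ‖Q‖ ^ (∑ t ∈ Finset.range n, (n + t + 1)) := fun s => by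
    rw [hfdef, norm_mul, norm_padeWeight hQ0 hQ (by omega)]
  -- Beyond the gap the weights have constant norm, so the tail decreases as the Euler terms do and
  -- its first term gives the norm.
  have hratio : ∀ s, ‖f (s + 1 + (2 * n + 1))‖
      ≤ ‖Q‖ ^ n * ‖x‖ * ‖f (s + (2 * n + 1))‖ := fun s => by
    rw [hnorm, hnorm, add_right_comm s 1, norm_eulerTerm_succ hQ, ← mul_assoc]
    have : ‖Q‖ ^ (s + (2 * n + 1)) ≤ ‖Q‖ ^ n :=
      pow_le_pow_of_le_one (norm_nonneg _) hQ.le (by omega)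
    gcongr
  refine ⟨∑' s, f (s + (2 * n + 1)), ?_, ?_⟩
  · rw [norm_tsum_eq_norm_zero (f := fun s => f (s + (2 * n + 1)))
      ((summable_nat_add_iff _).2 hf) (by positivity) hn hratio, hnorm,
      zero_add, norm_eulerTerm hQ, pow_add]
    ring
  · have htot := hsum.tsum_eq
    rw [tsum_mul_left] at htot
    have hhead : ∑ s ∈ Finset.range (n + 1), f s = ∑ s ∈ Finset.range (2 * n + 1), f s := by
      refine Finset.sum_subset (by intro s; simp; omega) fun s _ hs => ?_
      simp only [Finset.mem_range] at *
      rw [hfdef, padeWeight_eq_zero Q (by omega) (by omega), mul_zero]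
    rw [← htot, ← mul_sub, ← hf.sum_add_tsum_nat_add (2 * n + 1), hhead, add_sub_cancel_left]

end Analysis

/-! ### Denominators and archimedean sizes -/

section Height

variable {K : Type*} [Field K]

/-- `D * a ^ e * x` is an integer of absolute value at most `C * P ^ e`. -/
def HasHeight (a P : ℕ) (x : K) (D e C : ℕ) : Prop :=
  ∃ z : ℤ, (D : K) * (a : K) ^ e * x = z ∧ z.natAbs ≤ C * P ^ e

namespace HasHeight

variable {a P : ℕ} {x y : K} {D D' e e' C C' : ℕ}

theorem mul (hx : HasHeight a P x D e C) (hy : HasHeight a P y D' e' C') :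
    HasHeight a P (x * y) (D * D') (e + e') (C * C') := by
  obtain ⟨z, hz, hzC⟩ := hx
  obtain ⟨z', hz', hzC'⟩ := hy
  refine ⟨z * z', ?_, ?_⟩
  · push_cast
    rw [← hz, ← hz']
    ring
  · rw [Int.natAbs_mul]
    calc _ ≤ (C * P ^ e) * (C' * P ^ e') := Nat.mul_le_mul hzC hzC'
      _ = _ := by ring

theorem sub (hx : HasHeight a P x D e C) (hy : HasHeight a P y D e C') :
    HasHeight a P (x - y) D e (C + C') := by
  obtain ⟨z, hz, hzC⟩ := hx
  obtain ⟨z', hz', hzC'⟩ := hy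
  refine ⟨z - z', ?_, ?_⟩
  · push_cast
    rw [← hz, ← hz']
    ring
  · rw [add_mul]
    exact (Int.natAbs_sub_le z z').trans (Nat.add_le_add hzC hzC')

theorem add (hx : HasHeight a P x D e C) (hy : HasHeight a P y D e C') :
    HasHeight a P (x + y) D e (C + C') := by
  obtain ⟨z, hz, hzC⟩ := hx
  obtain ⟨z', hz', hzC'⟩ := hy
  refine ⟨z + z', ?_, ?_⟩
  · push_cast
    rw [← hz, ← hz']
    ring
  · rw [add_mul]
    exact (Int.natAbs_add_le z z').trans (Nat.add_le_add hzC hzC')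

/-- Each superfluous factor `a` costs at most a factor `P`, so terms of different degree in `Q` can
share one denominator. -/
theorem mono (hx : HasHeight a P x D e C) (haP : a ≤ P) (he : e ≤ e') (hC : C ≤ C') :
    HasHeight a P x D e' C' := by
  obtain ⟨z, hz, hzC⟩ := hx
  obtain ⟨k, rfl⟩ := Nat.exists_eq_add_of_le he
  refine ⟨a ^ k * z, ?_, ?_⟩
  · push_cast
    rw [← hz]
    ring
  · rw [Int.natAbs_mul, Int.natAbs_pow, Int.natAbs_natCast]
    calc a ^ k * z.natAbs ≤ P ^ k * (C' * P ^ e) :=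
          Nat.mul_le_mul (Nat.pow_le_pow_left haP k) (hzC.trans (Nat.mul_le_mul_right _ hC))
      _ = _ := by ring

theorem den_mul (hx : HasHeight a P x D e C) (m : ℕ) : HasHeight a P x (m * D) e (m * C) := by
  obtain ⟨z, hz, hzC⟩ := hx
  refine ⟨m * z, ?_, ?_⟩
  · push_cast
    rw [← hz]
    ring
  · rw [Int.natAbs_mul, Int.natAbs_natCast, mul_assoc]
    exact Nat.mul_le_mul_left _ hzC

theorem intCast (u : ℤ) : HasHeight a P (u : K) 1 0 u.natAbs := ⟨u, by simp, by simp⟩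

theorem one : HasHeight a P (1 : K) 1 0 1 := ⟨1, by simp, by simp⟩

theorem prod {n : ℕ} {f : ℕ → K} {e : ℕ → ℕ} {D C : ℕ}
    (h : ∀ i < n, HasHeight a P (f i) D (e i) C) :
    HasHeight a P (∏ i ∈ Finset.range n, f i) (D ^ n) (∑ i ∈ Finset.range n, e i) (C ^ n) := by
  induction n with
  | zero => simpa using one
  | succ n ih =>
    rw [Finset.prod_range_succ, Finset.sum_range_succ, pow_succ, pow_succ]
    exact (ih fun i hi => h i (by omega)).mul (h n (by omega))

theorem sum {n : ℕ} {f : ℕ → K} (h : ∀ i < n, HasHeight a P (f i) D e C) :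
    HasHeight a P (∑ i ∈ Finset.range n, f i) D e (n * C) := by
  induction n with
  | zero => exact ⟨0, by simp, by simp⟩
  | succ n ih =>
    rw [Finset.sum_range_succ, add_mul, one_mul]
    exact (ih fun i hi => h i (by omega)).add (h n (by omega))

variable {Q w : K}

theorem pow (hQ : (a : K) * Q = P) (l : ℕ) : HasHeight a P (Q ^ l) 1 l 1 :=
  ⟨P ^ l, by push_cast; rw [← hQ]; ring, by simp [Int.natAbs_pow]⟩

theorem pow_sub_pow (haP : a ≤ P) (hQ : (a : K) * Q = P) {u s : ℕ} (h : s ≤ u) :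
    HasHeight a P (Q ^ u - Q ^ s) 1 u 2 :=
  (pow hQ u).sub ((pow hQ s).mono haP h le_rfl)

theorem pow_sub_one (haP : a ≤ P) (hQ : (a : K) * Q = P) (u : ℕ) :
    HasHeight a P (Q ^ u - 1) 1 u 2 := by
  simpa using pow_sub_pow haP hQ (Nat.zero_le u)

variable {d : ℕ} {c : ℤ}

theorem of_mul_eq (hw : (d : K) * w = c) : HasHeight a P w d 0 c.natAbs :=
  ⟨c, by simpa using hw, by simp⟩

theorem eulerFactor (haP : a ≤ P) (hQ : (a : K) * Q = P) (hw : (d : K) * w = c) (l : ℕ) :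
    HasHeight a P (1 - Q ^ l * w) d l (d + c.natAbs) := by
  have h1 : HasHeight a P (1 : K) d l d := by
    simpa using (one.den_mul d).mono haP (Nat.zero_le l) le_rfl
  have h2 : HasHeight a P (Q ^ l * w) d l c.natAbs := by
    simpa using (pow hQ l).mul (of_mul_eq hw)
  exact h1.sub h2

theorem eulerProd (haP : a ≤ P) (hQ : (a : K) * Q = P) (hw : (d : K) * w = c) (n : ℕ) :
    HasHeight a P (eulerProd Q w n) (d ^ n) (∑ l ∈ Finset.range n, l) ((d + c.natAbs) ^ n) :=
  prod fun l _ => eulerFactor haP hQ hw l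

theorem shiftForm (haP : a ≤ P) (hQ : (a : K) * Q = P) (hw : (d : K) * w = c) (n j i : ℕ) :
    HasHeight a P (shiftForm Q w n j i) (d ^ n)
      (∑ l ∈ Finset.range n, l + ∑ t ∈ Finset.range j, (n + t + 1))
      (2 ^ j * (d + c.natAbs) ^ n) := by
  induction j generalizing i with
  | zero =>
    simp only [_root_.shiftForm, Finset.range_zero, Finset.sum_empty, add_zero, pow_zero, one_mul]
    refine prod fun l _ => ?_
    split_ifs
    · exact eulerFactor haP hQ hw l
    · simpa using (one.den_mul d).mono haP (Nat.zero_le l) (show d * 1 ≤ d + c.natAbs by omega)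
  | succ j ih =>
    rw [Finset.sum_range_succ, pow_succ, mul_two, add_mul]
    simp only [_root_.shiftForm]
    refine HasHeight.sub ?_ ((ih (i + 1)).mono haP (by omega) le_rfl)
    have := (pow hQ (n + j + 1)).mul (ih i)
    rw [one_mul, one_mul] at this
    exact this.mono haP (by omega) le_rfl

theorem qPoch (haP : a ≤ P) (hQ : (a : K) * Q = P) (n : ℕ) :
    HasHeight a P (qPoch Q n) 1 (∑ m ∈ Finset.range n, (m + 1)) (2 ^ n) := by
  simpa [_root_.qPoch] using prod (n := n) (e := fun m => m + 1) (D := 1)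
    fun m _ => pow_sub_one haP hQ (m + 1)

theorem pow_of_le (hw : (d : K) * w = c) {s n : ℕ} (hs : s ≤ n) :
    HasHeight a P (w ^ s) (d ^ n) 0 ((d + c.natAbs) ^ n) := by
  obtain ⟨k, rfl⟩ := Nat.exists_eq_add_of_le hs
  refine ⟨d ^ k * c ^ s, ?_, ?_⟩
  · push_cast
    rw [← hw]
    ring
  · rw [Int.natAbs_mul, Int.natAbs_pow, Int.natAbs_pow, Int.natAbs_natCast, pow_zero, mul_one,
      pow_add, mul_comm]
    exact Nat.mul_le_mul (Nat.pow_le_pow_left (by omega) _) (Nat.pow_le_pow_left (by omega) _)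

theorem padeWeight (haP : a ≤ P) (hQ : (a : K) * Q = P) {n s : ℕ} (hs : s ≤ n) (j : ℕ) :
    HasHeight a P (padeWeight Q n j s) 1 (∑ t ∈ Finset.range j, (n + t + 1)) (2 ^ j) := by
  simpa [_root_.padeWeight] using prod (n := j) (e := fun t => n + t + 1) (D := 1)
    fun t _ => pow_sub_pow haP hQ (show s ≤ n + t + 1 by omega)

theorem qPoch_mul_eulerTerm (haP : a ≤ P) (hQ : (a : K) * Q = P) (hw : (d : K) * w = c)
    {n s : ℕ} (hs : s ≤ n) (h0 : _root_.qPoch Q s ≠ 0) :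
    HasHeight a P (_root_.qPoch Q n * eulerTerm Q w s) (d ^ n) (∑ m ∈ Finset.range n, (m + 1))
      (2 ^ n * (d + c.natAbs) ^ n) := by
  -- The power `Q ^ (s.choose 2)` is spread as `∏ Q ^ m` over the `s` places freed by cancelling
  -- `qPoch Q s`. The `m`-th factor then has degree at most `m + 1`, whatever `s` is.
  have h1 : HasHeight a P (∏ m ∈ Finset.range n, if m < s then Q ^ m else Q ^ (m + 1) - 1)
      (1 ^ n) (∑ m ∈ Finset.range n, (m + 1)) (2 ^ n) := by
    refine prod fun m _ => ?_
    split_ifs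
    · exact (pow hQ m).mono haP (by omega) (by omega)
    · exact pow_sub_one haP hQ (m + 1)
  have h2 : _root_.qPoch Q n * eulerTerm Q w s
      = (∏ m ∈ Finset.range n, if m < s then Q ^ m else Q ^ (m + 1) - 1) * w ^ s := by
    obtain ⟨k, rfl⟩ := Nat.exists_eq_add_of_le hs
    have h3 : ∏ m ∈ Finset.range s, (if m < s then Q ^ m else Q ^ (m + 1) - 1)
        = Q ^ (s.choose 2) := by
      rw [Nat.choose_two_right, ← Finset.sum_range_id, ← Finset.prod_pow_eq_pow_sum]
      exact Finset.prod_congr rfl fun m hm => by simp [Finset.mem_range.1 hm]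
    rw [Finset.prod_range_add, h3, eulerTerm]
    rw [_root_.qPoch, Finset.prod_range_add, ← _root_.qPoch]
    have h4 : ∀ m, ¬ s + m < s := fun m => by omega
    simp only [h4, if_false]
    field_simp
  rw [h2]
  simpa using h1.mul (pow_of_le hw hs)

end HasHeight

end Height

/-! ### Comparison of exponents and the size inequality for integers -/

/-- The sum `∑ (n + t + 1)` occurs in both the height and the remainder exponents; what is left
shows a net `p`-adic gain of `n ^ 2 + n`. -/
theorem sum_range_add_sum_range_succ (n : ℕ) :
    ∑ l ∈ Finset.range n, l + ∑ m ∈ Finset.range n, (m + 1) + (n ^ 2 + n)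
      = (2 * n + 1).choose 2 := by
  induction n with
  | zero => simp
  | succ n ih =>
    rw [Finset.sum_range_succ, Finset.sum_range_succ,
      show 2 * (n + 1) + 1 = 2 * n + 1 + 1 + 1 by ring,
      Nat.choose_succ_succ' _ 1, Nat.choose_succ_succ' _ 1, Nat.choose_one_right,
      Nat.choose_one_right, ← ih]
    ring

/-- The exact power of `p` dividing `z` is at most `|z|`. -/
theorem one_le_natAbs_mul_padic_norm {p : ℕ} [hp : Fact p.Prime] {z : ℤ} (hz : z ≠ 0) :
    1 ≤ (z.natAbs : ℝ) * ‖(z : ℚ_[p])‖ := by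
  have hz' : (z : ℚ_[p]) ≠ 0 := by exact_mod_cast hz
  have hn := Padic.norm_eq_zpow_neg_valuation hz'
  rw [Padic.valuation_intCast] at hn
  have hdvd := (Padic.norm_int_le_pow_iff_dvd (p := p) z (padicValInt p z)).1 hn.le
  have hle : p ^ padicValInt p z ≤ z.natAbs :=
    Nat.le_of_dvd (by omega) (by rw [← Int.natCast_dvd]; exact_mod_cast hdvd)
  have hpos : (0 : ℝ) < (p : ℝ) ^ padicValInt p z := by
    have := hp.out.pos
    positivity
  rw [hn, zpow_neg, zpow_natCast, ← div_eq_mul_inv, one_le_div hpos]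
  exact_mod_cast hle

theorem eventually_mul_pow_lt_pow_sq {P : ℕ} (hP : 1 < P) {A B : ℝ} (hB : 0 < B) :
    ∀ᶠ n : ℕ in Filter.atTop, A * (n + 1) * B ^ n < (P : ℝ) ^ (n ^ 2 + n) := by
  have hP' : (1 : ℝ) < P := by exact_mod_cast hP
  have h0 := tendsto_pow_const_div_const_pow_of_one_lt 1 hP'
  have h1 := tendsto_pow_const_div_const_pow_of_one_lt 0 hP'
  have h := (h0.add h1).const_mul A
  rw [add_zero, mul_zero] at h
  filter_upwards [h.eventually_lt_const one_pos,
    (tendsto_pow_atTop_atTop_of_one_lt hP').eventually_ge_atTop B] with n hn hBn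
  have hpos : (0 : ℝ) < (P : ℝ) ^ n := by positivity
  rw [pow_one, pow_zero, ← add_div, mul_div_assoc', div_lt_one hpos] at hn
  calc A * (n + 1) * B ^ n < (P : ℝ) ^ n * B ^ n := by gcongr
    _ ≤ (P : ℝ) ^ n * ((P : ℝ) ^ n) ^ n := by gcongr
    _ = _ := by ring

/-! ### Irrationality of nonzero values of the Euler series -/

section Irrationality

variable {p : ℕ} [Fact p.Prime]

theorem eulerProd_ne_zero_of_eulerSeries_ne_zero {Q w : ℚ_[p]} (hQ : ‖Q‖ < 1)
    (h : ∑' s, eulerTerm Q w s ≠ 0) (n : ℕ) : eulerProd Q w n ≠ 0 := by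
  rw [eulerSeries_eq_eulerProd_mul hQ w n] at h
  exact left_ne_zero_of_mul h

theorem norm_eulerProd_le {Q w : ℚ_[p]} (hQ : ‖Q‖ < 1) (n : ℕ) :
    ‖eulerProd Q w n‖ ≤ (1 + ‖w‖) ^ n := by
  rw [eulerProd, norm_prod]
  have h : ∏ _l ∈ Finset.range n, (1 + ‖w‖) = (1 + ‖w‖) ^ n := by simp
  rw [← h]
  refine Finset.prod_le_prod (fun _ _ => norm_nonneg _) fun l _ => ?_
  refine (norm_sub_le _ _).trans ?_
  rw [norm_one, norm_mul, norm_pow]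
  gcongr
  exact mul_le_of_le_one_left (norm_nonneg _) (pow_le_one₀ (norm_nonneg _) hQ.le)

/-- The linear form `u * A - v * B` in the approximants `A`, `B`, with denominators cleared. -/
theorem hasHeight_linearForm {a P d : ℕ} {c : ℤ} {Q w : ℚ_[p]} (hQ : ‖Q‖ < 1) (haP : a ≤ P)
    (haQ : (a : ℚ_[p]) * Q = P) (hw : (d : ℚ_[p]) * w = c) (u v : ℤ) (n : ℕ) :
    HasHeight a P (qPoch Q n * (u * shiftForm Q w n n 0 - v * (eulerProd Q w n *
        ∑ s ∈ Finset.range (n + 1), eulerTerm Q w s * padeWeight Q n n s)))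
      (d ^ n * d ^ n)
      (∑ l ∈ Finset.range n, l + ∑ m ∈ Finset.range n, (m + 1)
        + ∑ t ∈ Finset.range n, (n + t + 1))
      ((u.natAbs + v.natAbs) * (n + 1) * (4 * (d + c.natAbs) ^ 2) ^ n) := by
  set L := d + c.natAbs with hL
  have hA := (((HasHeight.intCast u).mul (HasHeight.qPoch haP haQ n)).mul
    (HasHeight.shiftForm haP haQ hw n n 0)).den_mul (d ^ n)
  have hT : HasHeight a P (∑ s ∈ Finset.range (n + 1),
      qPoch Q n * eulerTerm Q w s * padeWeight Q n n s) _ _ _ := HasHeight.sum fun s hs =>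
    (HasHeight.qPoch_mul_eulerTerm haP haQ hw (Nat.le_of_lt_succ hs) (qPoch_ne_zero hQ s)).mul
      (HasHeight.padeWeight haP haQ (Nat.le_of_lt_succ hs) n)
  have hB := ((HasHeight.intCast v).mul (HasHeight.eulerProd haP haQ hw n)).mul hT
  simp only [one_mul, mul_one, zero_add, ← hL] at hA hB
  have h4 : (4 * L ^ 2) ^ n = 2 ^ n * 2 ^ n * (L ^ n * L ^ n) := by
    rw [mul_pow, show 4 = 2 * 2 by rfl, mul_pow, ← pow_mul, mul_comm 2 n, pow_mul, sq]
  have hdL : d ^ n ≤ L ^ n := Nat.pow_le_pow_left (by omega) n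
  have hA' := hA.mono (e' := ∑ l ∈ Finset.range n, l + ∑ m ∈ Finset.range n, (m + 1)
      + ∑ t ∈ Finset.range n, (n + t + 1))
    (C' := u.natAbs * (n + 1) * (4 * L ^ 2) ^ n) haP (by omega) (by
      calc d ^ n * (u.natAbs * 2 ^ n * (2 ^ n * L ^ n))
          ≤ L ^ n * (u.natAbs * 2 ^ n * (2 ^ n * L ^ n)) := Nat.mul_le_mul_right _ hdL
        _ = u.natAbs * 1 * (2 ^ n * 2 ^ n * (L ^ n * L ^ n)) := by ring
        _ ≤ u.natAbs * (n + 1) * (2 ^ n * 2 ^ n * (L ^ n * L ^ n)) := by gcongr; omega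
        _ = _ := by rw [h4])
  have hB' := hB.mono (e' := ∑ l ∈ Finset.range n, l + ∑ m ∈ Finset.range n, (m + 1)
      + ∑ t ∈ Finset.range n, (n + t + 1))
    (C' := v.natAbs * (n + 1) * (4 * L ^ 2) ^ n) haP (by omega) (by
      rw [h4]
      exact le_of_eq (by ring))
  have h := hA'.sub hB'
  rw [← add_mul, ← add_mul] at h
  convert h using 1
  rw [← mul_assoc (v : ℚ_[p]), mul_sub, mul_left_comm (qPoch Q n) (_ * _),
    Finset.mul_sum _ _ (qPoch Q n)]
  simp only [mul_assoc, mul_left_comm]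

theorem eulerSeries_irrational_or_zero {a P d : ℕ} {c : ℤ} {Q w : ℚ_[p]} (hP : 1 < P)
    (hQP : ‖Q‖ = (P : ℝ)⁻¹) (haP : a ≤ P) (ha : a ≠ 0) (haQ : (a : ℚ_[p]) * Q = P)
    (hd : d ≠ 0) (hc : c ≠ 0) (hw : (d : ℚ_[p]) * w = c) :
    IsPadicIrrational (∑' s, eulerTerm Q w s) ∨ ∑' s, eulerTerm Q w s = 0 := by
  by_contra! hcon
  obtain ⟨hrat, hF⟩ := hcon
  simp only [IsPadicIrrational, not_not] at hrat
  obtain ⟨r, hr⟩ := hrat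
  have hP' : (1 : ℝ) < P := by exact_mod_cast hP
  have hQ : ‖Q‖ < 1 := by rw [hQP]; exact inv_lt_one_of_one_lt₀ hP'
  have hQ0 : Q ≠ 0 := by
    rw [← norm_ne_zero_iff, hQP]
    positivity
  have hw0 : w ≠ 0 := by
    rintro rfl
    rw [mul_zero] at hw
    exact hc (by exact_mod_cast hw.symm)
  have hwpos : 0 < ‖w‖ := norm_pos_iff.2 hw0
  obtain ⟨u, v, hv0, hvF⟩ : ∃ u v : ℤ, (v : ℚ_[p]) ≠ 0 ∧
      (v : ℚ_[p]) * ∑' s, eulerTerm Q w s = u := by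
    refine ⟨r.num, r.den, by exact_mod_cast r.den_ne_zero, ?_⟩
    rw [← hr]
    exact_mod_cast congrArg (fun x : ℚ => (x : ℚ_[p])) (Rat.den_mul_eq_num r)
  have hlim : Filter.Tendsto (fun s : ℕ => ‖Q‖ ^ s * ‖w‖) Filter.atTop (nhds (0 * ‖w‖)) :=
    (tendsto_pow_atTop_nhds_zero_of_lt_one (norm_nonneg _) hQ).mul_const _
  rw [zero_mul] at hlim
  -- In `B`, the factor `4 (d + |c|) ^ 2` comes from the height, `1 + ‖w‖` from `eulerProd`, and
  -- `‖w‖ ^ 2` from the remainder, whose odd factor `‖w‖` goes into `A`.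
  obtain ⟨n, hn, hlt⟩ := ((hlim.eventually_lt_const one_pos).and
    (eventually_mul_pow_lt_pow_sq hP (A := ((u.natAbs : ℝ) + v.natAbs) * ‖w‖)
      (B := 4 * ((d : ℝ) + c.natAbs) ^ 2 * (1 + ‖w‖) * ‖w‖ ^ 2) (by positivity))).exists
  have hprod := eulerProd_ne_zero_of_eulerSeries_ne_zero hQ hF n
  obtain ⟨R, hRnorm, hR⟩ := exists_remainder hQ0 hQ hn hprod
  obtain ⟨z, hz, hzC⟩ := hasHeight_linearForm hQ haP haQ hw u v n
  rw [← hvF, mul_assoc (v : ℚ_[p]), ← mul_sub (v : ℚ_[p]), hR] at hz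
  have hR0 : R ≠ 0 := by
    rw [← norm_ne_zero_iff, hRnorm]
    have := norm_pos_iff.2 hQ0
    positivity
  have hz0 : z ≠ 0 := by
    have : (z : ℚ_[p]) ≠ 0 := by
      rw [← hz]
      have hq := qPoch_ne_zero hQ n
      have ha' : (a : ℚ_[p]) ≠ 0 := by exact_mod_cast ha
      have hd' : ((d ^ n * d ^ n : ℕ) : ℚ_[p]) ≠ 0 := by
        have : d ^ n * d ^ n ≠ 0 := by positivity
        exact_mod_cast this
      exact mul_ne_zero (mul_ne_zero hd' (pow_ne_zero _ ha'))
        (mul_ne_zero hq (mul_ne_zero hv0 (mul_ne_zero hprod hR0)))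
    exact_mod_cast this
  have hznorm : ‖(z : ℚ_[p])‖ ≤ (1 + ‖w‖) ^ n * ‖R‖ := by
    rw [← hz, norm_mul, norm_mul, norm_mul, norm_mul, norm_mul, norm_qPoch hQ, norm_pow, one_mul]
    have h1 : ‖((d ^ n * d ^ n : ℕ) : ℚ_[p])‖ ≤ 1 := by
      simpa using Padic.norm_int_le_one (p := p) ((d ^ n * d ^ n : ℕ) : ℤ)
    have h2 : ‖(a : ℚ_[p])‖ ≤ 1 := by simpa using Padic.norm_int_le_one (p := p) (a : ℤ)
    have h3 : ‖(v : ℚ_[p])‖ ≤ 1 := Padic.norm_int_le_one v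
    have h4 : ∀ e : ℕ, ‖((d ^ n * d ^ n : ℕ) : ℚ_[p])‖ * ‖(a : ℚ_[p])‖ ^ e ≤ 1 := fun e =>
      mul_le_one₀ h1 (by positivity) (pow_le_one₀ (norm_nonneg _) h2)
    refine (mul_le_of_le_one_left (by positivity) (h4 _)).trans ?_
    refine (mul_le_of_le_one_left (by positivity) h3).trans ?_
    exact mul_le_mul_of_nonneg_right (norm_eulerProd_le hQ n) (norm_nonneg _)
  have hone := one_le_natAbs_mul_padic_norm (p := p) hz0
  rw [hRnorm, hQP, ← sum_range_add_sum_range_succ, add_right_comm, inv_pow] at hznorm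
  set e := ∑ l ∈ Finset.range n, l + ∑ m ∈ Finset.range n, (m + 1)
        + ∑ t ∈ Finset.range n, (n + t + 1)
  have hzC' : (z.natAbs : ℝ) ≤ ((u.natAbs : ℝ) + v.natAbs) * (n + 1)
      * (4 * ((d : ℝ) + c.natAbs) ^ 2) ^ n * (P : ℝ) ^ e := by exact_mod_cast hzC
  have hfin : 1 ≤ (((u.natAbs : ℝ) + v.natAbs) * (n + 1)
      * (4 * ((d : ℝ) + c.natAbs) ^ 2) ^ n * (P : ℝ) ^ e)
      * ((1 + ‖w‖) ^ n * (((P : ℝ) ^ (e + (n ^ 2 + n)))⁻¹ * ‖w‖ ^ (2 * n + 1))) :=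
    hone.trans (mul_le_mul hzC' hznorm (norm_nonneg _) (by positivity))
  refine absurd hlt (not_lt.2 ?_)
  have hPe : (0 : ℝ) < (P : ℝ) ^ e := by positivity
  have hPn : (0 : ℝ) < (P : ℝ) ^ (n ^ 2 + n) := by positivity
  have hmul := mul_le_mul_of_nonneg_left hfin hPn.le
  rw [mul_one] at hmul
  refine hmul.trans (le_of_eq ?_)
  rw [pow_add (P : ℝ) e, mul_pow (4 * _ * _), mul_pow (4 * _) (1 + _), ← pow_mul ‖w‖,
    pow_succ ‖w‖]
  field_simp

end Irrationality

/-! ### The two `q`-exponentials and their reciprocity -/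

section QExponential

variable {p : ℕ} [Fact p.Prime]

theorem qFactorial_eq {K : Type*} [Field K] (q : K) (n : ℕ) :
    qFactorial q n = (∏ m ∈ Finset.range n, (1 - q ^ (m + 1))) / (1 - q) ^ n := by
  induction n with
  | zero => simp [qFactorial]
  | succ n ih =>
    rw [qFactorial, Finset.prod_Icc_succ_top (by omega), ← qFactorial, ih, qNumber,
      Finset.prod_range_succ, pow_succ (1 - q), div_mul_div_comm]

theorem qExpTerm_eq_div_qPoch {K : Type*} [Field K] (Q z : K) (n : ℕ) :
    qExpTerm Q z n = (z * (Q - 1)) ^ n / qPoch Q n := by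
  have h : ∏ m ∈ Finset.range n, (1 - Q ^ (m + 1)) = (-1) ^ n * qPoch Q n := by
    rw [qPoch, ← Finset.card_range n, ← Finset.prod_const, Finset.card_range,
      ← Finset.prod_mul_distrib]
    exact Finset.prod_congr rfl fun _ _ => by ring
  rw [qExpTerm, qFactorial_eq, h, ← neg_sub Q 1, neg_pow (Q - 1), mul_div_mul_left _ _ (by simp),
    mul_pow, div_div_eq_mul_div]

theorem qExpTerm_inv_eq_eulerTerm {K : Type*} [Field K] {Q : K} (hQ : Q ≠ 0) (z : K) (n : ℕ) :
    qExpTerm Q⁻¹ z n = eulerTerm Q (z * (Q - 1)) n := by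
  have h : ∏ m ∈ Finset.range n, (1 - Q⁻¹ ^ (m + 1)) = qPoch Q n / (Q ^ (n.choose 2) * Q ^ n) := by
    rw [← pow_add, add_comm, ← Nat.choose_one_right n, Nat.choose_one_right,
      show n + n.choose 2 = (n + 1).choose 2 by rw [Nat.choose_succ_succ' n 1]; simp,
      Nat.choose_two_right, ← Finset.sum_range_id, Finset.sum_range_succ', add_zero,
      ← Finset.prod_pow_eq_pow_sum, qPoch, ← Finset.prod_div_distrib]
    refine Finset.prod_congr rfl fun m _ => ?_
    have hm := pow_ne_zero (m + 1) hQ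
    rw [inv_pow, eq_div_iff hm, sub_mul, inv_mul_cancel₀ hm, one_mul]
  have h1 : 1 - Q⁻¹ = (Q - 1) / Q := by field_simp
  rw [qExpTerm, qFactorial_eq, h, h1, eulerTerm, div_pow, mul_pow, div_div_eq_mul_div,
    div_div_eq_mul_div]
  field_simp

/-- With `G(x) = ∑ x ^ n / qPoch Q n`, one has `G(Q x) = (1 + x) G(x)` and `F(-x) = (1 + x) F(-Q
x)`. Hence `G(x) F(-x)` is invariant under `x ↦ Q x`, and both factors tend to `1` along `Q ^ k x →
0`. -/
theorem eulerInvSeries_mul_eulerSeries {K : Type*} [NormedField K] [IsUltrametricDist K]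
    [CompleteSpace K] {Q x : K} (hQ : ‖Q‖ < 1) (hx : ‖x‖ < 1) :
    Summable (fun n => x ^ n / qPoch Q n) ∧
      (∑' n, x ^ n / qPoch Q n) * ∑' n, eulerTerm Q (-x) n = 1 := by
  have hnorm : ∀ (y : K) n, ‖y ^ n / qPoch Q n‖ = ‖y‖ ^ n := fun y n => by
    rw [norm_div, norm_qPoch hQ, norm_pow, div_one]
  have hsum : ∀ y : K, ‖y‖ < 1 → Summable (fun n => y ^ n / qPoch Q n) := fun y hy =>
    Summable.of_norm (by simpa only [hnorm] using summable_geometric_of_lt_one (norm_nonneg _) hy)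
  have hQx : ∀ k, ‖Q ^ k * x‖ ≤ ‖x‖ := fun k => by
    rw [norm_mul, norm_pow]
    exact mul_le_of_le_one_left (norm_nonneg _) (pow_le_one₀ (norm_nonneg _) hQ.le)
  have hfun : ∀ y : K, ‖y‖ < 1 → ‖Q * y‖ < 1 →
      ∑' n, (Q * y) ^ n / qPoch Q n = (1 + y) * ∑' n, y ^ n / qPoch Q n := by
    intro y hy hQy
    have h1 := hsum y hy
    have h2 := hsum _ hQy
    have h : ∀ s, (Q * y) ^ (s + 1) / qPoch Q (s + 1) - y ^ (s + 1) / qPoch Q (s + 1)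
        = y * (y ^ s / qPoch Q s) := fun s => by
      have := qPoch_ne_zero hQ s
      have := pow_succ_sub_one_ne_zero hQ s
      rw [qPoch_succ]
      field_simp
      ring
    have key : ∑' n, (Q * y) ^ n / qPoch Q n - ∑' n, y ^ n / qPoch Q n
        = y * ∑' n, y ^ n / qPoch Q n := by
      rw [← tsum_mul_left, ← tsum_congr h, Summable.tsum_sub
        ((summable_nat_add_iff 1).2 h2) ((summable_nat_add_iff 1).2 h1),
        h1.tsum_eq_zero_add, h2.tsum_eq_zero_add]
      simp
    linear_combination key
  have hinv : ∀ k, (∑' n, x ^ n / qPoch Q n) * ∑' n, eulerTerm Q (-x) n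
      = (∑' n, (Q ^ k * x) ^ n / qPoch Q n) * ∑' n, eulerTerm Q (-(Q ^ k * x)) n := by
    intro k
    induction k with
    | zero => simp
    | succ k ih =>
      have hk : Q ^ (k + 1) * x = Q * (Q ^ k * x) := by ring
      rw [ih, hk, hfun _ ((hQx k).trans_lt hx) (hk ▸ (hQx (k + 1)).trans_lt hx),
        eulerSeries_eq hQ (-(Q ^ k * x)), mul_neg]
      ring
  have hxk : Filter.Tendsto (fun k : ℕ => ‖Q ^ k * x‖) Filter.atTop (nhds 0) := by
    have := (tendsto_pow_atTop_nhds_zero_of_lt_one (norm_nonneg _) hQ).mul_const ‖x‖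
    simpa using this
  have hbound : ∀ (f : ℕ → K) (y : K), Summable f → f 0 = 1 → ‖y‖ < 1 →
      (∀ n, ‖f n‖ ≤ ‖y‖ ^ n) → ‖(∑' n, f n) - 1‖ ≤ ‖y‖ := by
    intro f y hf h0 hy hle
    rw [hf.tsum_eq_zero_add, h0, add_sub_cancel_left]
    refine IsUltrametricDist.norm_tsum_le_of_forall_le_of_nonneg (norm_nonneg _) fun n => ?_
    exact (hle (n + 1)).trans (pow_le_of_le_one (norm_nonneg _) hy.le (by omega))
  have hl1 : Filter.Tendsto (fun k : ℕ => ∑' n, (Q ^ k * x) ^ n / qPoch Q n)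
      Filter.atTop (nhds 1) := by
    rw [tendsto_iff_norm_sub_tendsto_zero]
    refine squeeze_zero (fun _ => norm_nonneg _) (fun k => ?_) hxk
    have hk := (hQx k).trans_lt hx
    exact hbound _ _ (hsum _ hk) (by simp [qPoch_zero]) hk fun n => (hnorm _ n).le
  have hl2 : Filter.Tendsto (fun k : ℕ => ∑' n, eulerTerm Q (-(Q ^ k * x)) n)
      Filter.atTop (nhds 1) := by
    rw [tendsto_iff_norm_sub_tendsto_zero]
    refine squeeze_zero (fun _ => norm_nonneg _) (fun k => ?_) hxk
    have hk := (hQx k).trans_lt hx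
    refine hbound _ _ (summable_eulerTerm hQ _) (eulerTerm_zero _ _) hk fun n => ?_
    rw [norm_eulerTerm hQ, norm_neg]
    exact mul_le_of_le_one_left (by positivity) (pow_le_one₀ (norm_nonneg _) hQ.le)
  refine ⟨hsum x hx, ?_⟩
  have hl := hl1.mul hl2
  simp only [← hinv, mul_one] at hl
  exact tendsto_nhds_unique tendsto_const_nhds hl

theorem summable_qExp_and_irrational_or_zero {q ξ : ℚ} (hq0 : 0 < q) (hq1 : q < 1)
    (hden : ∃ k : ℕ, q.den = p ^ k) (hξ : ξ ≠ 0) :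
    ‖((q : ℚ_[p])⁻¹)‖ < 1 ∧ Summable (qExpTerm (q : ℚ_[p]) (ξ : ℚ_[p])) ∧
      (IsPadicIrrational (qExpSeries (q : ℚ_[p]) (ξ : ℚ_[p])) ∨
        qExpSeries (q : ℚ_[p]) (ξ : ℚ_[p]) = 0) := by
  obtain ⟨k, hk⟩ := hden
  have hnum : 0 < q.num := Rat.num_pos.2 hq0
  have hlt : q.num < q.den := by
    have := Rat.lt_iff q 1
    simpa using this.1 hq1
  have hk0 : k ≠ 0 := by
    rintro rfl
    rw [hk] at hlt
    simp at hlt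
    omega
  set a := q.num.natAbs with ha
  have haZ : (a : ℤ) = q.num := by omega
  have hqa : (a : ℚ) = q * q.den := by
    rw [Rat.mul_den_eq_num, ← haZ]
    rfl
  -- Lowest terms make the numerator a `p`-adic unit, so `‖q⁻¹‖` is exactly `1 / q.den`, the same
  -- `P` that bounds the heights.
  have hcop : p.Coprime a := by
    have h := q.reduced
    rw [hk] at h
    exact (Nat.Coprime.coprime_dvd_right (dvd_pow_self p hk0) h).symm
  have hanorm : ‖(a : ℚ_[p])‖ = 1 := Padic.norm_natCast_eq_one_iff.2 hcop
  have hq' : (q : ℚ_[p]) ≠ 0 := by exact_mod_cast hq0.ne'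
  have hqa' : (a : ℚ_[p]) = q * q.den := by exact_mod_cast congrArg (fun x : ℚ => (x : ℚ_[p])) hqa
  have haQ : (a : ℚ_[p]) * (q : ℚ_[p])⁻¹ = (q.den : ℕ) := by
    rw [hqa']
    field_simp
  have hQP : ‖(q : ℚ_[p])⁻¹‖ = ((q.den : ℕ) : ℝ)⁻¹ := by
    have := congrArg norm haQ
    rw [norm_mul, hanorm, one_mul] at this
    rw [this, hk]
    simp
  have hP : 1 < q.den := by omega
  have hQ : ‖(q : ℚ_[p])⁻¹‖ < 1 := by
    rw [hQP]
    exact inv_lt_one_of_one_lt₀ (by exact_mod_cast hP)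
  set w : ℚ := ξ * (q⁻¹ - 1) with hwdef
  have hw0 : w ≠ 0 := mul_ne_zero hξ (sub_ne_zero.2 (by
    intro h
    rw [inv_eq_one.1 h] at hq1
    exact lt_irrefl _ hq1))
  have hterm : qExpTerm (q : ℚ_[p]) (ξ : ℚ_[p]) = eulerTerm (q : ℚ_[p])⁻¹ (w : ℚ_[p]) := by
    funext n
    have := qExpTerm_inv_eq_eulerTerm (inv_ne_zero hq') (ξ : ℚ_[p]) n
    rw [inv_inv] at this
    rw [this, hwdef]
    push_cast
    rfl
  have hwd : (w.den : ℚ_[p]) * (w : ℚ_[p]) = (w.num : ℤ) := by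
    exact_mod_cast congrArg (fun x : ℚ => (x : ℚ_[p])) (Rat.den_mul_eq_num w)
  refine ⟨hQ, hterm ▸ summable_eulerTerm hQ _, ?_⟩
  rw [qExpSeries, hterm]
  exact eulerSeries_irrational_or_zero hP hQP (by omega) (by omega) haQ w.den_ne_zero
    (Rat.num_ne_zero.2 hw0) hwd

end QExponential

theorem mainTheorem10 (p : ℕ) [Fact p.Prime] (q ξ : ℚ) (hq0 : 0 < q) (hq1 : q < 1)
    (hden : ∃ k : ℕ, q.den = p ^ k) (hξ : ξ ≠ 0) :
    (Summable (qExpTerm (q : ℚ_[p]) (ξ : ℚ_[p])) ∧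
      (IsPadicIrrational (qExpSeries (q : ℚ_[p]) (ξ : ℚ_[p])) ∨
        qExpSeries (q : ℚ_[p]) (ξ : ℚ_[p]) = 0)) ∧
    (‖(ξ : ℚ_[p])‖ < 1 →
      Summable (qExpTerm ((q : ℚ_[p])⁻¹) (ξ : ℚ_[p])) ∧
        IsPadicIrrational (qExpSeries ((q : ℚ_[p])⁻¹) (ξ : ℚ_[p]))) := by
  refine ⟨(summable_qExp_and_irrational_or_zero hq0 hq1 hden hξ).2, fun hξ1 => ?_⟩
  -- The first part is used at `-ξ`, whose value is the reciprocal of the one sought; this also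
  -- excludes the value zero.
  obtain ⟨hQ, -, hneg⟩ :=
    summable_qExp_and_irrational_or_zero (p := p) hq0 hq1 hden (neg_ne_zero.2 hξ)
  have hq' : (q : ℚ_[p]) ≠ 0 := by exact_mod_cast hq0.ne'
  have hx : ‖(ξ : ℚ_[p]) * ((q : ℚ_[p])⁻¹ - 1)‖ < 1 := by
    have := norm_pow_succ_sub_one hQ 0
    rw [zero_add, pow_one] at this
    rwa [norm_mul, this, mul_one]
  obtain ⟨hsum, hprod⟩ := eulerInvSeries_mul_eulerSeries hQ hx
  have hterm : qExpTerm (q : ℚ_[p])⁻¹ (ξ : ℚ_[p])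
      = fun n => ((ξ : ℚ_[p]) * ((q : ℚ_[p])⁻¹ - 1)) ^ n / qPoch (q : ℚ_[p])⁻¹ n :=
    funext fun n => qExpTerm_eq_div_qPoch _ _ n
  have hterm' : qExpTerm (q : ℚ_[p]) ((-ξ : ℚ) : ℚ_[p])
      = eulerTerm (q : ℚ_[p])⁻¹ (-((ξ : ℚ_[p]) * ((q : ℚ_[p])⁻¹ - 1))) := by
    funext n
    have := qExpTerm_inv_eq_eulerTerm (inv_ne_zero hq') ((-ξ : ℚ) : ℚ_[p]) n
    rw [inv_inv] at this
    rw [this]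
    push_cast
    rw [neg_mul]
  rw [← hterm] at hsum
  refine ⟨hsum, ?_⟩
  rw [← tsum_congr (fun n => congrFun hterm n), ← hterm'] at hprod
  change qExpSeries _ _ * qExpSeries _ _ = 1 at hprod
  rintro ⟨r, hr⟩
  rcases hneg with hirr | hzero
  · refine hirr ⟨r⁻¹, ?_⟩
    rw [← hr] at hprod
    rw [eq_inv_of_mul_eq_one_right hprod]
    push_cast
    rfl
  · rw [hzero, mul_zero] at hprod
    exact zero_ne_one hprod
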